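/- For a connected graph $G$ on $n$ vertices, let $\partial_1(G)\ge\partial_2(G)\ge\cdots\ge\partial_n(G)$ be the eigenvalues, counted with multiplicity, of its distance matrix $D(G)=(d(u,v))_{u,v\in V(G)}$. Let $G$ be a finite simple connected graph of order $n\ge 4$ that is not complete and satisfies $-3\le\partial_n(G)$ and $\partial_3(G)\le -1$. Then at least one of the following holds: (I) $G\cong K_r\vee(K_{s_1}\cup\cdots\cup K_{s_i})$ for some integers $r\ge 1$, $i\ge 2$ and $s_1,\dots,s_i\ge 1$; (II) $G\cong (K_{s_1}\cup\cdots\cup K_{s_i})\vee(K_{t_1}\cup\cdots\cup K_{t_j})$ for some integers $i,j\ge 2$ and $s_1,\dots,s_i,t_1,\dots,t_j\ge 1$. Here $K_m$ is the complete graph on $m$ vertices, $\cup$ denotes disjoint union, and the join $H_1\vee H_2$ of two vertex-disjoint graphs is obtained from their disjoint union by adding all edges between a vertex of $H_1$ and a vertex of $H_2$. -/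

import Mathlib

universe u v

/-- The join `G ∨ H` of two vertex-disjoint graphs: the disjoint union of `G` and `H` together with
all edges between a vertex of `G` and a vertex of `H`. -/
def graphJoin {V : Type u} {W : Type v} (G : SimpleGraph V) (H : SimpleGraph W) :
    SimpleGraph (V ⊕ W) :=
  (G ⊕g H) ⊔ completeBipartiteGraph V W

/-- The disjoint union `K_{s 0} ∪ ⋯ ∪ K_{s (i-1)}` of complete graphs: two distinct vertices are
adjacent exactly when they lie in the same component. -/
def unionOfCompleteGraphs {i : ℕ} (s : Fin i → ℕ) : SimpleGraph (Σ k : Fin i, Fin (s k)) where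
  Adj x y := x ≠ y ∧ x.1 = y.1
  symm := ⟨fun _ _ h => ⟨h.1.symm, h.2.symm⟩⟩
  loopless := ⟨fun _ h => h.1 rfl⟩

/-- The distance matrix of a (connected) graph. -/
noncomputable def distanceMatrix {V : Type u} (G : SimpleGraph V) : Matrix V V ℝ :=
  Matrix.of fun x y => (G.dist x y : ℝ)

theorem distanceMatrix_isHermitian {V : Type u} (G : SimpleGraph V) :
    (distanceMatrix G).IsHermitian := by
  ext x y
  simp [distanceMatrix, SimpleGraph.dist_comm]

/-- The distance eigenvalues of `G`, with multiplicity and in non-increasing order. They are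
indexed from `0`, so `∂_k` is `distanceEigenvalue G` at the index `k - 1`. -/
noncomputable def distanceEigenvalue {V : Type u} [Fintype V] [DecidableEq V] (G : SimpleGraph V) :
    Fin (Fintype.card V) → ℝ :=
  (distanceMatrix_isHermitian G).eigenvalues₀

/-- `G` belongs to `𝒢[-3 ≤ ∂_n, ∂_3 ≤ -1]`: it is a non-complete connected graph of order
`n ≥ 4` with `-3 ≤ ∂_n(G)` and `∂_3(G) ≤ -1`. -/
structure IsInDistanceClass {V : Type u} [Fintype V] [DecidableEq V] (G : SimpleGraph V) :
    Prop where
  connected : G.Connected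
  not_complete : G ≠ ⊤
  four_le_card : 4 ≤ Fintype.card V
  neg_three_le_last : -3 ≤ distanceEigenvalue G ⟨Fintype.card V - 1, by omega⟩
  third_le_neg_one : distanceEigenvalue G ⟨2, by omega⟩ ≤ -1

/-!
If `∂_n(G) > -(2 + √2)`, the least distance eigenvalue of the path on four vertices, then no
geodesic of `G` has length three, so `G` has diameter at most two. Then `D(G) + I = J + A(Gᶜ)`, and
`∂_3(G) ≤ -1` says that this form has at most two positive squares. Testing it on small
configurations of `Gᶜ`, and using that the ends of an edge of `Gᶜ` have a common non-neighbour in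
`Gᶜ`, one finds that a component of `Gᶜ` with an edge is complete multipartite, and so is the rest
of `Gᶜ`.
-/

open Matrix QuadraticMap QuadraticForm SimpleGraph

section Signature

theorem finrank_le_sigPos_of_posDef_comp {M M' : Type*} [AddCommGroup M] [Module ℝ M]
    [FiniteDimensional ℝ M] [AddCommGroup M'] [Module ℝ M'] {Q : QuadraticForm ℝ M}
    {f : M' →ₗ[ℝ] M} (hQ : (Q.comp f).PosDef) : Module.finrank ℝ M' ≤ sigPos Q := by
  have f_injective : Function.Injective f :=
    (injective_iff_map_eq_zero f).2 fun x hx => by_contra fun hx0 => by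
      simpa [hx] using hQ x hx0
  rw [← LinearMap.finrank_range_of_inj f_injective]
  refine le_sigPos_of_posDef Q ?_
  rintro ⟨_, x, rfl⟩ hx
  exact hQ x fun hx0 => hx (by simp [hx0])

theorem sigPos_comp_le {M M' : Type*} [AddCommGroup M] [Module ℝ M] [FiniteDimensional ℝ M]
    [AddCommGroup M'] [Module ℝ M'] [FiniteDimensional ℝ M'] (Q : QuadraticForm ℝ M)
    (f : M' →ₗ[ℝ] M) : sigPos (Q.comp f) ≤ sigPos Q := by
  obtain ⟨V, hV, hpos⟩ := exists_finrank_eq_sigPos_and_posDef (Q.comp f)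
  exact hV ▸ finrank_le_sigPos_of_posDef_comp (f := f ∘ₗ V.subtype) hpos

variable {n m ι : Type*} [Fintype n] [DecidableEq n] [Fintype m]

theorem toQuadraticForm'_comp_mulVecLin [DecidableEq m] (B : Matrix n n ℝ) (W : Matrix n m ℝ) :
    B.toQuadraticForm'.comp W.mulVecLin = (Wᵀ * B * W).toQuadraticForm' := by
  ext x
  simp [toQuadraticForm', toLinearMap₂'_apply', ← mulVec_mulVec, dotProduct_mulVec,
    vecMul_transpose]

theorem toQuadraticForm'_diagonal (w : n → ℝ) :
    (diagonal w).toQuadraticForm' = weightedSumSquares ℝ w := by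
  ext x
  simp [toQuadraticForm', toLinearMap₂'_apply', weightedSumSquares_apply, dotProduct,
    mulVec_diagonal, mul_left_comm]

theorem card_le_sigPos_of_posDef_submatrix [Fintype ι] {B : Matrix n n ℝ} (f : ι → n)
    (W : Matrix ι m ℝ) (hW : (Wᵀ * B.submatrix f f * W).PosDef) :
    Fintype.card m ≤ sigPos B.toQuadraticForm' := by
  classical
  let E : Matrix n ι ℝ := (1 : Matrix n n ℝ).submatrix id f
  have hE : B.submatrix f f = Eᵀ * B * E := by
    ext i j
    simp [E, mul_apply, one_apply]
  have hEW : Wᵀ * B.submatrix f f * W = (E * W)ᵀ * B * (E * W) := by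
    simp only [hE, transpose_mul, Matrix.mul_assoc]
  rw [hEW] at hW
  rw [← Module.finrank_fintype_fun_eq_card (η := m) ℝ]
  refine finrank_le_sigPos_of_posDef_comp (f := (E * W).mulVecLin) ?_
  rw [toQuadraticForm'_comp_mulVecLin]
  exact hW.toQuadraticForm'

theorem card_le_sigPos_of_submatrix_eq [Fintype ι] [DecidableEq m] {B : Matrix n n ℝ} {f : ι → n}
    {M : Matrix ι ι ℝ} (hf : B.submatrix f f = M) (W : Matrix ι m ℝ) {d : m → ℝ}
    (hd : ∀ j, 0 < d j) (hW : Wᵀ * M * W = diagonal d) :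
    Fintype.card m ≤ sigPos B.toQuadraticForm' := by
  subst hf
  exact card_le_sigPos_of_posDef_submatrix f W (hW ▸ posDef_diagonal_iff.2 hd)

theorem sub_smul_one_eq_transpose_mul_diagonal_mul {A : Matrix n n ℝ} (hA : A.IsHermitian)
    (c : ℝ) :
    A - c • 1 = (star hA.eigenvectorUnitary : Matrix n n ℝ)ᵀ *
      diagonal (fun i => hA.eigenvalues i - c) * (star hA.eigenvectorUnitary : Matrix n n ℝ) := by
  have hU : (hA.eigenvectorUnitary : Matrix n n ℝ) *
      star (hA.eigenvectorUnitary : Matrix n n ℝ) = 1 :=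
    Unitary.mul_star_self_of_mem hA.eigenvectorUnitary.2
  have hT : (star (hA.eigenvectorUnitary : Matrix n n ℝ))ᵀ = hA.eigenvectorUnitary := by
    rw [star_eq_conjTranspose, conjTranspose_eq_transpose_of_trivial, transpose_transpose]
  have hdiag : diagonal (fun i => hA.eigenvalues i - c) = diagonal hA.eigenvalues - c • 1 := by
    rw [smul_one_eq_diagonal, diagonal_sub]
  have hA_eq := hA.spectral_theorem
  rw [Unitary.conjStarAlgAut_apply] at hA_eq
  rw [hdiag, hT, mul_sub, sub_mul, mul_smul_comm, mul_one, smul_mul_assoc, hU]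
  exact congrArg (· - c • 1) hA_eq

theorem posDef_sub_smul_one_of_lt_eigenvalues {A : Matrix n n ℝ} (hA : A.IsHermitian) {c : ℝ}
    (hc : ∀ i, c < hA.eigenvalues i) : (A - c • 1).PosDef := by
  have hU : IsUnit (star (hA.eigenvectorUnitary : Matrix n n ℝ)) :=
    (Unitary.toUnits (star hA.eigenvectorUnitary)).isUnit
  rw [sub_smul_one_eq_transpose_mul_diagonal_mul hA, ← conjTranspose_eq_transpose_of_trivial,
    ← star_eq_conjTranspose]
  exact (IsUnit.posDef_star_left_conjugate_iff hU).2
    (posDef_diagonal_iff.2 fun i => sub_pos.2 (hc i))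

theorem sigPos_sub_smul_one_le {A : Matrix n n ℝ} (hA : A.IsHermitian) (c : ℝ) :
    sigPos (A - c • 1).toQuadraticForm' ≤ {i | c < hA.eigenvalues i}.ncard := by
  rw [sub_smul_one_eq_transpose_mul_diagonal_mul hA, ← toQuadraticForm'_comp_mulVecLin,
    toQuadraticForm'_diagonal]
  refine (sigPos_comp_le _ _).trans_eq ?_
  simp only [sigPos_weightedSumSquares, sub_pos]

theorem sigPos_sub_smul_one_le_of_eigenvalues₀_le {A : Matrix n n ℝ} (hA : A.IsHermitian) {c : ℝ}
    {k : ℕ} (hc : ∀ i : Fin (Fintype.card n), k ≤ i → hA.eigenvalues₀ i ≤ c) :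
    sigPos (A - c • 1).toQuadraticForm' ≤ k := by
  let e : Fin (Fintype.card n) ≃ n := Fintype.equivOfCardEq (Fintype.card_fin _)
  have hlt : ∀ i ∈ {i | c < hA.eigenvalues i}, (e.symm i : ℕ) ∈ Set.Iio k := fun i hi =>
    lt_of_not_ge fun hki => (hc _ hki).not_gt hi
  calc sigPos (A - c • 1).toQuadraticForm'
    _ ≤ {i | c < hA.eigenvalues i}.ncard := sigPos_sub_smul_one_le hA c
    _ ≤ (Set.Iio k).ncard :=
      Set.ncard_le_ncard_of_injOn _ hlt (Fin.val_injective.comp e.symm.injective).injOn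
    _ = k := by rw [Set.ncard_eq_toFinset_card', Set.toFinset_Iio, Nat.card_Iio]

end Signature

section ForbiddenConfigurations

open Classical in
/-- The matrix `J + A(H)`, where `J` is the all-ones matrix. It is the distance matrix plus the
identity when `H` is the complement of a connected graph of diameter at most two. -/
noncomputable def onesAddAdjMatrix {V : Type*} (H : SimpleGraph V) : Matrix V V ℝ :=
  of 1 + H.adjMatrix ℝ

variable {V : Type*} [Fintype V] [DecidableEq V] {H : SimpleGraph V}

open Classical in
theorem card_lt_sigPos_of_not_adj {ι m : Type*} [Fintype ι] [Fintype m] [DecidableEq m]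
    {f : ι → V} {M : Matrix ι ι ℝ} (hf : (H.adjMatrix ℝ).submatrix f f = M) {z : V}
    (hz : ∀ i, ¬ H.Adj (f i) z) (W : Matrix ι m ℝ) {d : m → ℝ} (hd : ∀ j, 0 < d j)
    (hW : Wᵀ * M * W = diagonal d) :
    Fintype.card m < sigPos (onesAddAdjMatrix H).toQuadraticForm' := by
  let f' : ι ⊕ Unit → V := Sum.elim f fun _ => z
  let u : Matrix ι Unit ℝ := of 1
  -- Subtracting the column sums of `W` at `z` makes the columns orthogonal to the all-ones vector,
  -- so that the form sees only `A(H)` on them; the unit vector at `z` is one more positive vector.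
  let W' : Matrix (ι ⊕ Unit) (m ⊕ Unit) ℝ := fromBlocks W 0 (-(uᵀ * W)) 1
  have hf' : (onesAddAdjMatrix H).submatrix f' f' = fromBlocks (u * uᵀ + M) u uᵀ 1 := by
    ext (i | i) (j | j) <;> simp [← hf, onesAddAdjMatrix, f', u, mul_apply, hz, H.adj_comm z]
  have hW' : W'ᵀ * fromBlocks (u * uᵀ + M) u uᵀ 1 * W' = diagonal (Sum.elim d 1) := by
    rw [Matrix.mul_assoc, fromBlocks_multiply, fromBlocks_transpose, fromBlocks_multiply,
      ← fromBlocks_diagonal, ← hW]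
    simp [Matrix.add_mul, Matrix.mul_assoc]
  have hd' : ∀ j, 0 < Sum.elim d (1 : Unit → ℝ) j := Sum.forall.2 ⟨hd, fun _ => one_pos⟩
  simpa [Nat.add_one_le_iff] using card_le_sigPos_of_submatrix_eq hf' W' hd' hW'

theorem two_lt_sigPos_of_two_edges {a b c d z : V} (hab : H.Adj a b) (hac : ¬ H.Adj a c)
    (had : ¬ H.Adj a d) (hbc : ¬ H.Adj b c) (hbd : ¬ H.Adj b d) (hcd : H.Adj c d)
    (haz : ¬ H.Adj a z) (hbz : ¬ H.Adj b z) (hcz : ¬ H.Adj c z) (hdz : ¬ H.Adj d z) :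
    2 < sigPos (onesAddAdjMatrix H).toQuadraticForm' := by
  classical
  have hadj : (H.adjMatrix ℝ).submatrix ![a, b, c, d] ![a, b, c, d] =
      !![0, 1, 0, 0; 1, 0, 0, 0; 0, 0, 0, 1; 0, 0, 1, 0] := by
    ext i j
    fin_cases i <;> fin_cases j <;> simp [*, H.adj_comm]
  refine card_lt_sigPos_of_not_adj hadj (z := z) (by simp [Fin.forall_fin_succ, *])
    !![1, 0; 1, 0; 0, 1; 0, 1] (d := ![2, 2]) (by simp) ?_
  ext i j
  fin_cases i <;> fin_cases j <;> norm_num [mul_apply, Fin.sum_univ_succ]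

theorem two_lt_sigPos_of_path_four {a b c d z : V} (hab : H.Adj a b) (hac : ¬ H.Adj a c)
    (had : ¬ H.Adj a d) (hbc : H.Adj b c) (hbd : ¬ H.Adj b d) (hcd : H.Adj c d)
    (haz : ¬ H.Adj a z) (hbz : ¬ H.Adj b z) (hcz : ¬ H.Adj c z) (hdz : ¬ H.Adj d z) :
    2 < sigPos (onesAddAdjMatrix H).toQuadraticForm' := by
  classical
  have hadj : (H.adjMatrix ℝ).submatrix ![a, b, c, d] ![a, b, c, d] =
      !![0, 1, 0, 0; 1, 0, 1, 0; 0, 1, 0, 1; 0, 0, 1, 0] := by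
    ext i j
    fin_cases i <;> fin_cases j <;> simp [*, H.adj_comm]
  refine card_lt_sigPos_of_not_adj hadj (z := z) (by simp [Fin.forall_fin_succ, *])
    !![1, 1; 1, 1; 1, -1; 1, -1] (d := ![6, 2]) (by simp) ?_
  ext i j
  fin_cases i <;> fin_cases j <;> norm_num [mul_apply, Fin.sum_univ_succ]

theorem two_lt_sigPos_of_paw {a b c d z : V} (hab : H.Adj a b) (hac : H.Adj a c) (had : H.Adj a d)
    (hbc : H.Adj b c) (hbd : ¬ H.Adj b d) (hcd : ¬ H.Adj c d) (haz : ¬ H.Adj a z)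
    (hbz : ¬ H.Adj b z) (hcz : ¬ H.Adj c z) (hdz : ¬ H.Adj d z) :
    2 < sigPos (onesAddAdjMatrix H).toQuadraticForm' := by
  classical
  have hadj : (H.adjMatrix ℝ).submatrix ![a, b, c, d] ![a, b, c, d] =
      !![0, 1, 1, 1; 1, 0, 1, 0; 1, 1, 0, 0; 1, 0, 0, 0] := by
    ext i j
    fin_cases i <;> fin_cases j <;> simp [*, H.adj_comm]
  refine card_lt_sigPos_of_not_adj hadj (z := z) (by simp [Fin.forall_fin_succ, *])
    !![0, 1; 1, -1; 1, -1; 0, 2] (d := ![2, 2]) (by simp) ?_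
  ext i j
  fin_cases i <;> fin_cases j <;> norm_num [mul_apply, Fin.sum_univ_succ]

theorem two_lt_sigPos_of_path_five {a b c d e : V} (hab : H.Adj a b) (hac : ¬ H.Adj a c)
    (had : ¬ H.Adj a d) (hae : ¬ H.Adj a e) (hbc : H.Adj b c) (hbd : ¬ H.Adj b d)
    (hbe : ¬ H.Adj b e) (hcd : H.Adj c d) (hce : ¬ H.Adj c e) (hde : H.Adj d e) :
    2 < sigPos (onesAddAdjMatrix H).toQuadraticForm' := by
  have hadj : (onesAddAdjMatrix H).submatrix ![a, b, c, d, e] ![a, b, c, d, e] =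
      !![1, 2, 1, 1, 1; 2, 1, 2, 1, 1; 1, 2, 1, 2, 1; 1, 1, 2, 1, 2; 1, 1, 1, 2, 1] := by
    ext i j
    fin_cases i <;> fin_cases j <;> norm_num [onesAddAdjMatrix, *, H.adj_comm]
  -- Reversing the path negates the first column and fixes the other two.
  refine card_le_sigPos_of_submatrix_eq hadj
    !![1, -4, 0; 1, 1, 0; 0, 4, 1; -1, 1, 0; -1, -4, 0] (d := ![4, 4, 1])
    (by simp [Fin.forall_fin_succ]) ?_
  ext i j
  fin_cases i <;> fin_cases j <;> norm_num [mul_apply, Fin.sum_univ_succ]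

theorem two_lt_sigPos_of_cycle_five {a b c d e : V} (hab : H.Adj a b) (hac : ¬ H.Adj a c)
    (had : ¬ H.Adj a d) (hae : H.Adj a e) (hbc : H.Adj b c) (hbd : ¬ H.Adj b d)
    (hbe : ¬ H.Adj b e) (hcd : H.Adj c d) (hce : ¬ H.Adj c e) (hde : H.Adj d e) :
    2 < sigPos (onesAddAdjMatrix H).toQuadraticForm' := by
  have hadj : (onesAddAdjMatrix H).submatrix ![a, b, c, d, e] ![a, b, c, d, e] =
      !![1, 2, 1, 1, 2; 2, 1, 2, 1, 1; 1, 2, 1, 2, 1; 1, 1, 2, 1, 2; 2, 1, 1, 2, 1] := by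
    ext i j
    fin_cases i <;> fin_cases j <;> norm_num [onesAddAdjMatrix, *, H.adj_comm]
  refine card_le_sigPos_of_submatrix_eq hadj
    !![1, -2, 1; 1, 1, 1; 0, 2, 1; -1, 1, 1; -1, -2, 1] (d := ![2, 8, 35])
    (by simp [Fin.forall_fin_succ]) ?_
  ext i j
  fin_cases i <;> fin_cases j <;> norm_num [mul_apply, Fin.sum_univ_succ]

end ForbiddenConfigurations

section Complement

variable {V : Type*} [Fintype V] [DecidableEq V] {H : SimpleGraph V}

theorem adj_of_path_four (hpos : sigPos (onesAddAdjMatrix H).toQuadraticForm' ≤ 2)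
    (hnbr : ∀ a b, H.Adj a b → ∃ z, ¬ H.Adj a z ∧ ¬ H.Adj b z) {a b c d : V} (hab : H.Adj a b)
    (hbc : H.Adj b c) (hcd : H.Adj c d) (hac : ¬ H.Adj a c) (hbd : ¬ H.Adj b d) : H.Adj a d := by
  by_contra had
  obtain ⟨z, hbz, hcz⟩ := hnbr b c hbc
  refine hpos.not_gt ?_
  by_cases haz : H.Adj a z <;> by_cases hdz : H.Adj d z
  · exact two_lt_sigPos_of_cycle_five hab hac had haz hbc hbd hbz hcd hcz hdz
  · exact two_lt_sigPos_of_path_five haz.symm (by rwa [H.adj_comm]) (by rwa [H.adj_comm])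
      (by rwa [H.adj_comm]) hab hac had hbc hbd hcd
  · exact two_lt_sigPos_of_path_five hab hac had haz hbc hbd hbz hcd hcz hdz
  · exact two_lt_sigPos_of_path_four hab hac had hbc hbd hcd haz hbz hcz hdz

theorem adj_or_adj_of_triangle (hpos : sigPos (onesAddAdjMatrix H).toQuadraticForm' ≤ 2)
    (hnbr : ∀ a b, H.Adj a b → ∃ z, ¬ H.Adj a z ∧ ¬ H.Adj b z) {a b c d : V} (hab : H.Adj a b)
    (hbc : H.Adj b c) (hac : H.Adj a c) (had : H.Adj a d) : H.Adj b d ∨ H.Adj c d := by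
  by_contra! ⟨hbd, hcd⟩
  obtain ⟨z, haz, hbz⟩ := hnbr a b hab
  have hdz : ¬ H.Adj d z := fun hdz =>
    hbz (adj_of_path_four hpos hnbr hab.symm had hdz hbd haz)
  have hcz : ¬ H.Adj c z := fun hcz =>
    hdz (adj_of_path_four hpos hnbr had.symm hac hcz (by rwa [H.adj_comm]) haz)
  exact hpos.not_gt (two_lt_sigPos_of_paw hab hac had hbc hbd hcd haz hbz hcz hdz)

theorem adj_or_adj_of_reachable (hpos : sigPos (onesAddAdjMatrix H).toQuadraticForm' ≤ 2)
    (hnbr : ∀ a b, H.Adj a b → ∃ z, ¬ H.Adj a z ∧ ¬ H.Adj b z) {x z y : V} (hxz : H.Adj x z)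
    (hxy : H.Reachable x y) : H.Adj x y ∨ H.Adj z y := by
  -- The set of vertices adjacent to `x` or `z` contains `x` and is closed under adjacency.
  induction (reachable_iff_reflTransGen x y).1 hxy with
  | refl => exact .inr hxz.symm
  | @tail b y hreach hby ih =>
    specialize ih ((reachable_iff_reflTransGen x b).2 hreach)
    by_cases hxb : H.Adj x b <;> by_cases hzb : H.Adj z b
    · exact adj_or_adj_of_triangle hpos hnbr hxb.symm hxz hzb.symm hby
    · by_contra! ⟨hxy, hzy⟩
      exact hzy (adj_of_path_four hpos hnbr hxz.symm hxb hby hzb hxy)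
    · by_contra! ⟨hxy, hzy⟩
      exact hxy (adj_of_path_four hpos hnbr hxz hzb hby hxb hzy)
    · exact (ih.elim hxb hzb).elim

theorem isCompleteMultipartite_induce_supp
    (hpos : sigPos (onesAddAdjMatrix H).toQuadraticForm' ≤ 2)
    (hnbr : ∀ a b, H.Adj a b → ∃ z, ¬ H.Adj a z ∧ ¬ H.Adj b z) (C : H.ConnectedComponent) :
    (H.induce C.supp).IsCompleteMultipartite := by
  refine ⟨fun x y z hxy hyz hxz => ?_⟩
  exact (adj_or_adj_of_reachable hpos hnbr hxz (C.reachable_of_mem_supp x.2 y.2)).elim hxy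
    fun h => hyz h.symm

theorem isCompleteMultipartite_induce_compl_supp
    (hpos : sigPos (onesAddAdjMatrix H).toQuadraticForm' ≤ 2) {a b : V} (hab : H.Adj a b) :
    (H.induce (H.connectedComponentMk a).suppᶜ).IsCompleteMultipartite := by
  have not_adj_compl {v w : V} (hv : v ∈ (H.connectedComponentMk a).supp)
      (hw : w ∉ (H.connectedComponentMk a).supp) : ¬ H.Adj v w := fun hvw =>
    hw (ConnectedComponent.mem_supp_of_adj_mem_supp _ hv hvw)
  have ha : a ∈ (H.connectedComponentMk a).supp := rfl
  have hb := ConnectedComponent.mem_supp_of_adj_mem_supp _ ha hab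
  refine ⟨fun x y z hxy hyz hxz => hpos.not_gt ?_⟩
  exact two_lt_sigPos_of_two_edges hab (not_adj_compl ha x.2) (not_adj_compl ha z.2)
    (not_adj_compl hb x.2) (not_adj_compl hb z.2) hxz (not_adj_compl ha y.2)
    (not_adj_compl hb y.2) hxy fun h => hyz h.symm

end Complement

section Join

theorem exists_iso_unionOfCompleteGraphs {W : Type*} [Finite W] {G : SimpleGraph W}
    (hG : Gᶜ.IsCompleteMultipartite) (hne : G ≠ ⊤) :
    ∃ (i : ℕ) (s : Fin i → ℕ), 2 ≤ i ∧ (∀ k, 1 ≤ s k) ∧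
      Nonempty (G ≃g unionOfCompleteGraphs s) := by
  classical
  let e : Quotient hG.setoid ≃ Fin (Nat.card (Quotient hG.setoid)) := Finite.equivFin _
  let part : W → Fin (Nat.card (Quotient hG.setoid)) := fun w => e ⟦w⟧
  have part_eq_iff : ∀ x y, part x = part y ↔ x = y ∨ G.Adj x y := fun x y => by
    rw [e.apply_eq_iff_eq, Quotient.eq]
    change ¬ Gᶜ.Adj x y ↔ _
    rw [compl_adj, not_and_not_right, or_iff_not_imp_left]
  let f : W ≃ Σ k, Fin (Nat.card {w // part w = k}) :=
    (Equiv.sigmaFiberEquiv part).symm.trans (Equiv.sigmaCongrRight fun _ => Finite.equivFin _)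
  refine ⟨_, fun k => Nat.card {w // part w = k}, ?_, fun k => ?_, ⟨f, fun {x y} => ?_⟩⟩
  · obtain ⟨a, b, hab, hadj⟩ := ne_top_iff_exists_not_adj.1 hne
    have : Nontrivial (Quotient hG.setoid) := ⟨⟦a⟧, ⟦b⟧, fun h =>
      ((part_eq_iff a b).1 (congrArg e h)).elim hab hadj⟩
    exact Finite.one_lt_card
  · obtain ⟨w, hw⟩ := Quotient.exists_rep (e.symm k)
    have : Nonempty {w // part w = k} := ⟨w, by simp only [part, hw, e.apply_symm_apply]⟩
    exact Nat.card_pos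
  · change f x ≠ f y ∧ part x = part y ↔ G.Adj x y
    rw [f.injective.ne_iff, part_eq_iff]
    exact ⟨fun h => h.2.resolve_left h.1, fun h => ⟨h.ne, .inr h⟩⟩

/-- The join of two isomorphisms of graphs. -/
def graphJoinCongr {V V' W W' : Type*} {G : SimpleGraph V} {G' : SimpleGraph V'}
    {H : SimpleGraph W} {H' : SimpleGraph W'} (f : G ≃g G') (g : H ≃g H') :
    graphJoin G H ≃g graphJoin G' H' where
  toEquiv := Equiv.sumCongr f.toEquiv g.toEquiv
  map_rel_iff' := by
    rintro (x | x) (y | y) <;> simp [graphJoin, f.map_adj_iff, g.map_adj_iff]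

theorem compl_induce {V : Type*} (G : SimpleGraph V) (S : Set V) :
    (G.induce S)ᶜ = Gᶜ.induce S := by
  ext x y
  simp [Subtype.ext_iff]

theorem adj_of_notMem_supp_of_mem_supp {V : Type*} {G : SimpleGraph V}
    (C : Gᶜ.ConnectedComponent) {x y : V} (hx : x ∉ C.supp) (hy : y ∈ C.supp) : G.Adj x y := by
  by_contra hxy
  have hadj : Gᶜ.Adj y x := ⟨fun h => hx (h ▸ hy), fun h => hxy h.symm⟩
  exact hx (C.mem_supp_of_adj_mem_supp hy hadj)

open Classical in
/-- The decomposition of `G` as a join along a connected component `C` of its complement, with `C`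
as the second factor. -/
noncomputable def graphJoinIsoOfComplComponent {V : Type*} {G : SimpleGraph V}
    (C : Gᶜ.ConnectedComponent) : graphJoin (G.induce C.suppᶜ) (G.induce C.supp) ≃g G where
  toEquiv := (Equiv.sumComm _ _).trans (Equiv.Set.sumCompl C.supp)
  map_rel_iff' := by
    rintro (⟨x, hx⟩ | ⟨x, hx⟩) (⟨y, hy⟩ | ⟨y, hy⟩)
    · simp [graphJoin]
    · simpa [graphJoin] using adj_of_notMem_supp_of_mem_supp C hx hy
    · simpa [graphJoin] using (adj_of_notMem_supp_of_mem_supp C hy hx).symm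
    · simp [graphJoin]

theorem exists_iso_induce_supp {V : Type*} [Fintype V] [DecidableEq V] {G : SimpleGraph V}
    (hpos : sigPos (onesAddAdjMatrix Gᶜ).toQuadraticForm' ≤ 2)
    (hnbr : ∀ a b, Gᶜ.Adj a b → ∃ z, ¬ Gᶜ.Adj a z ∧ ¬ Gᶜ.Adj b z) {a b : V} (hab : Gᶜ.Adj a b) :
    ∃ (i : ℕ) (s : Fin i → ℕ), 2 ≤ i ∧ (∀ k, 1 ≤ s k) ∧
      Nonempty (G.induce (Gᶜ.connectedComponentMk a).supp ≃g unionOfCompleteGraphs s) := by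
  refine exists_iso_unionOfCompleteGraphs
    (compl_induce G _ ▸ isCompleteMultipartite_induce_supp hpos hnbr _) ?_
  have hb : b ∈ (Gᶜ.connectedComponentMk a).supp :=
    ConnectedComponent.mem_supp_of_adj_mem_supp _ rfl hab
  exact ne_top_iff_exists_not_adj.2
    ⟨⟨a, rfl⟩, ⟨b, hb⟩, fun h => hab.1 (congrArg Subtype.val h), hab.2⟩

end Join

section Distance

theorem dist_getVert_getVert {V : Type*} {G : SimpleGraph V} {u v : V} {p : G.Walk u v}
    (hp : p.length = G.dist u v) {i j : ℕ} (hij : i ≤ j) (hj : j ≤ p.length) :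
    G.dist (p.getVert i) (p.getVert j) = j - i := by
  have h := length_eq_dist_of_subwalk hp
    (((p.take j).isSubwalk_drop i).trans (p.isSubwalk_take j))
  rw [Walk.drop_length, Walk.take_length, min_eq_left hj, Walk.take_getVert, min_eq_right hij] at h
  exact h.symm

theorem not_posDef_distanceMatrix_path_four_add_smul_one :
    ¬ (!![0, 1, 2, 3; 1, 0, 1, 2; 2, 1, 0, 1; 3, 2, 1, 0] - (-(2 + √2)) • 1 :
      Matrix (Fin 4) (Fin 4) ℝ).PosDef := by
  intro h
  -- The test vector is an eigenvector for the least distance eigenvalue `-(2 + √2)` of the path.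
  have hpos := h.dotProduct_mulVec_pos (x := ![1, √2 - 1, 1 - √2, -1])
    (Function.ne_iff.2 ⟨0, by simp⟩)
  have hsq : √2 * √2 = 2 := Real.mul_self_sqrt two_pos.le
  have hker : (!![0, 1, 2, 3; 1, 0, 1, 2; 2, 1, 0, 1; 3, 2, 1, 0] - (-(2 + √2)) • 1) *ᵥ
      ![1, √2 - 1, 1 - √2, -1] = 0 := by
    rw [sub_mulVec, smul_mulVec, one_mulVec, sub_eq_zero]
    ext i
    fin_cases i <;> simp <;> linarith
  rw [hker, dotProduct_zero] at hpos
  exact hpos.false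

variable {V : Type*} {G : SimpleGraph V}

theorem dist_le_two_of_lt_distanceEigenvalue [Fintype V] [DecidableEq V] (hconn : G.Connected)
    (hmin : ∀ k, -(2 + √2) < distanceEigenvalue G k) (x y : V) : G.dist x y ≤ 2 := by
  by_contra! hxy
  obtain ⟨p, hp⟩ := hconn.exists_walk_length_eq_dist x y
  let f : Fin 4 → V := fun i => p.getVert i
  have dist_f : ∀ i j : Fin 4, i ≤ j → G.dist (f i) (f j) = j - i := fun i j hij =>
    dist_getVert_getVert hp hij (by omega)
  have hf : (distanceMatrix G).submatrix f f =
      !![0, 1, 2, 3; 1, 0, 1, 2; 2, 1, 0, 1; 3, 2, 1, 0] := by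
    ext i j
    simp only [distanceMatrix, submatrix_apply, of_apply]
    rcases le_total i j with hij | hij
    · rw [dist_f i j hij]
      fin_cases i <;> fin_cases j <;> simp at hij ⊢
    · rw [dist_comm, dist_f j i hij]
      fin_cases i <;> fin_cases j <;> simp at hij ⊢
  have f_injective : Function.Injective f := fun i j hij => Fin.ext <|
    (p.isPath_of_length_eq_dist hp).getVert_injOn (Set.mem_ofPred.2 (by omega))
      (Set.mem_ofPred.2 (by omega)) hij
  have hpos := (posDef_sub_smul_one_of_lt_eigenvalues (distanceMatrix_isHermitian G)
    fun i => hmin _).submatrix f_injective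
  rw [submatrix_sub, Pi.sub_apply, Pi.sub_apply, submatrix_smul, Pi.smul_apply, Pi.smul_apply,
    submatrix_one f f_injective, hf] at hpos
  exact not_posDef_distanceMatrix_path_four_add_smul_one hpos

theorem distanceMatrix_sub_neg_one_smul_one [DecidableEq V] (hconn : G.Connected)
    (hdist : ∀ x y, G.dist x y ≤ 2) :
    distanceMatrix G - (-1 : ℝ) • 1 = onesAddAdjMatrix Gᶜ := by
  ext x y
  by_cases hxy : x = y
  · simp [distanceMatrix, onesAddAdjMatrix, hxy]
  by_cases hadj : G.Adj x y
  · simp [distanceMatrix, onesAddAdjMatrix, hxy, hadj, dist_eq_one_iff_adj.2 hadj]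
  · have hdist_eq : G.dist x y = 2 :=
      (hdist x y).antisymm (hconn.one_lt_dist_of_ne_of_not_adj hxy hadj)
    norm_num [distanceMatrix, onesAddAdjMatrix, hxy, hadj, hdist_eq]

theorem exists_not_compl_adj (hconn : G.Connected) (hdist : ∀ x y, G.dist x y ≤ 2) {a b : V}
    (hab : Gᶜ.Adj a b) : ∃ z, ¬ Gᶜ.Adj a z ∧ ¬ Gᶜ.Adj b z := by
  rw [compl_adj] at hab
  have hdist_eq : G.dist a b = 2 :=
    (hdist a b).antisymm (hconn.one_lt_dist_of_ne_of_not_adj hab.1 hab.2)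
  have hedist : G.edist a b = 2 := by
    rw [← (hconn a b).coe_dist_eq_edist, hdist_eq, Nat.cast_ofNat]
  obtain ⟨-, -, z, haz, hbz⟩ := edist_eq_two_iff.1 hedist
  exact ⟨z, fun h => h.2 haz, fun h => h.2 hbz⟩

end Distance

theorem corollary3p13_general {V : Type*} [Fintype V] [DecidableEq V] (G : SimpleGraph V)
    (hconn : G.Connected) (hne : G ≠ ⊤) (hmin : ∀ k, -(2 + √2) < distanceEigenvalue G k)
    (hthird : ∀ k : Fin (Fintype.card V), 2 ≤ (k : ℕ) → distanceEigenvalue G k ≤ -1) :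
    (∃ (r i : ℕ) (s : Fin i → ℕ), 1 ≤ r ∧ 2 ≤ i ∧ (∀ k, 1 ≤ s k) ∧
      Nonempty (G ≃g graphJoin (SimpleGraph.completeGraph (Fin r)) (unionOfCompleteGraphs s))) ∨
    (∃ (i j : ℕ) (s : Fin i → ℕ) (t : Fin j → ℕ), 2 ≤ i ∧ 2 ≤ j ∧
      (∀ k, 1 ≤ s k) ∧ (∀ k, 1 ≤ t k) ∧
      Nonempty (G ≃g graphJoin (unionOfCompleteGraphs s) (unionOfCompleteGraphs t))) := by
  have hdist := dist_le_two_of_lt_distanceEigenvalue hconn hmin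
  have hpos : sigPos (onesAddAdjMatrix Gᶜ).toQuadraticForm' ≤ 2 :=
    distanceMatrix_sub_neg_one_smul_one hconn hdist ▸
      sigPos_sub_smul_one_le_of_eigenvalues₀_le (distanceMatrix_isHermitian G) hthird
  have hnbr : ∀ a b, Gᶜ.Adj a b → ∃ z, ¬ Gᶜ.Adj a z ∧ ¬ Gᶜ.Adj b z :=
    fun _ _ => exists_not_compl_adj hconn hdist
  obtain ⟨a, b, hab⟩ := ne_bot_iff_exists_adj.1 (compl_eq_bot.not.2 hne)
  let C := Gᶜ.connectedComponentMk a
  obtain ⟨j, t, hj, ht, ⟨e⟩⟩ := exists_iso_induce_supp hpos hnbr hab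
  by_cases htop : G.induce C.suppᶜ = ⊤
  · obtain ⟨z, haz, hbz⟩ := hnbr a b hab
    have hz : z ∉ C.supp := fun hz =>
      (adj_or_adj_of_reachable hpos hnbr hab (C.reachable_of_mem_supp rfl hz)).elim haz hbz
    have : Nonempty (C.suppᶜ : Set V) := ⟨z, hz⟩
    have completeIso : G.induce C.suppᶜ ≃g completeGraph (Fin (Nat.card (C.suppᶜ : Set V))) :=
      htop ▸ Iso.completeGraph (Finite.equivFin _)
    exact .inl ⟨_, j, t, Nat.card_pos, hj, ht,
      ⟨(graphJoinIsoOfComplComponent C).symm.trans (graphJoinCongr completeIso e)⟩⟩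
  · obtain ⟨i, s, hi, hs, ⟨e'⟩⟩ := exists_iso_unionOfCompleteGraphs
      (compl_induce G _ ▸ isCompleteMultipartite_induce_compl_supp hpos hab) htop
    exact .inr ⟨i, j, s, t, hi, hj, hs, ht,
      ⟨(graphJoinIsoOfComplComponent C).symm.trans (graphJoinCongr e' e)⟩⟩

theorem IsInDistanceClass.lt_distanceEigenvalue {V : Type*} [Fintype V] [DecidableEq V]
    {G : SimpleGraph V} (hG : IsInDistanceClass G) (k : Fin (Fintype.card V)) :
    -(2 + √2) < distanceEigenvalue G k := by
  calc -(2 + √2)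
    _ < -3 := by linarith [Real.one_lt_sqrt_two]
    _ ≤ distanceEigenvalue G ⟨Fintype.card V - 1, _⟩ := hG.neg_three_le_last
    _ ≤ distanceEigenvalue G k :=
      (distanceMatrix_isHermitian G).eigenvalues₀_antitone (Nat.le_sub_one_of_lt k.2)

theorem IsInDistanceClass.distanceEigenvalue_le {V : Type*} [Fintype V] [DecidableEq V]
    {G : SimpleGraph V} (hG : IsInDistanceClass G) (k : Fin (Fintype.card V)) (hk : 2 ≤ (k : ℕ)) :
    distanceEigenvalue G k ≤ -1 :=
  ((distanceMatrix_isHermitian G).eigenvalues₀_antitone hk).trans hG.third_le_neg_one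

theorem corollary3p13 {V : Type*} [Fintype V] [DecidableEq V] (G : SimpleGraph V)
    (hG : IsInDistanceClass G) :
    (∃ (r i : ℕ) (s : Fin i → ℕ), 1 ≤ r ∧ 2 ≤ i ∧ (∀ k, 1 ≤ s k) ∧
      Nonempty (G ≃g graphJoin (SimpleGraph.completeGraph (Fin r)) (unionOfCompleteGraphs s))) ∨
    (∃ (i j : ℕ) (s : Fin i → ℕ) (t : Fin j → ℕ), 2 ≤ i ∧ 2 ≤ j ∧
      (∀ k, 1 ≤ s k) ∧ (∀ k, 1 ≤ t k) ∧
      Nonempty (G ≃g graphJoin (unionOfCompleteGraphs s) (unionOfCompleteGraphs t))) := by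
  exact corollary3p13_general G hG.connected hG.not_complete hG.lt_distanceEigenvalue
    hG.distanceEigenvalue_le
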